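/- For integers $d>2$ and $m\ge 0$ and reals $\sigma,\gamma>0$, a linear regression task with $m$ data points consists of a design matrix $X\in\mathbb{R}^{m\times d}$ and a parameter $\theta\in\mathbb{R}^d$; its data are an observed response vector $y\sim\mathcal{N}(X\theta,\sigma^2 I_m)$ in $\mathbb{R}^m$. Let $\mathcal{P}^{(m)}_{LR}$ be the class of such tasks with $\|\theta\|_2\le 1$ and $\sigma_{\max}(X/\sqrt m)\le\gamma$, where $\sigma_{\max}$ is the largest singular value. Let $n,M,k\ge 0$ be integers with $nM+k\ge 1$. The learner observes independent response vectors $S_i\in\mathbb{R}^n$ ($i\le M$) from meta-training tasks $P_1,\dots,P_M\in\mathcal{P}^{(n)}_{LR}$ and $S_{M+1}\in\mathbb{R}^k$ from a novel task $P_{M+1}\in\mathcal{P}^{(k)}_{LR}$, and also knows all the design matrices. The novel-task minimax risk is $$R^*_{\mathcal{P}_{LR}}=\inf_{\hat\theta}\ \sup_{P_1,\dots,P_M\in\mathcal{P}^{(n)}_{LR},\ P_{M+1}\in\mathcal{P}^{(k)}_{LR}}\ \mathbb{E}\,\bigl\|\hat\theta_{S_{1:M}}(S_{M+1})-\theta_{P_{M+1}}\bigr\|_2^2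 ,$$ the infimum being over all measurable two-stage estimators $S_{1:M}\mapsto\hat\theta_{S_{1:M}}$, $\hat\theta_{S_{1:M}}:\mathbb{R}^k\to\mathbb{R}^d$ (which may depend on the design matrices). Then there is a universal constant $c>0$ (independent of $d,n,M,k,\sigma,\gamma$ and the design matrices) such that $$R^*_{\mathcal{P}_{LR}}\ \ge\ c\,\min\left\{1,\ \frac{d\sigma^2}{\gamma^2\,(2^{-d}nM+k)}\right\}.$$ The same lower bound holds, with the same $c$, for every prescribed choice of design matrices $X_1,\dots,X_M\in\mathbb{R}^{n\times d}$, $X_{M+1}\in\mathbb{R}^{k\times d}$ with $\sigma_{\max}(X_i/\sqrt n)\le\gamma$ for $i\le M$ and $\sigma_{\max}(X_{M+1}/\sqrt k)\le\gamma$, when the supremum is only over the parameters $\theta_1,\dots,\theta_{M+1}$ in the closed unit ball. -/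

import Mathlib

open MeasureTheory
open scoped ENNReal

noncomputable section

namespace MetaLinReg

/-- The largest singular value of a real matrix, seen as a linear map between Euclidean spaces.
(`LinearMap.singularValues` is listed in decreasing order, starting at index `0`.) -/
def sigmaMax {m d : ℕ} (A : Matrix (Fin m) (Fin d) ℝ) : ℝ :=
  (Matrix.toLpLin 2 2 A).singularValues 0

/-- The linear regression model `N(X θ, σ² I)` on `ℝᵐ`: the law of the vector of the `m` responses
of a task with design matrix `X` (one row per data point) and coefficient vector `θ`. -/
def regressionLaw {m d : ℕ} (σ : ℝ) (X : Matrix (Fin m) (Fin d) ℝ)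
    (θ : EuclideanSpace ℝ (Fin d)) : Measure (EuclideanSpace ℝ (Fin m)) :=
  ProbabilityTheory.multivariateGaussian (Matrix.toLpLin 2 2 X θ)
    (σ ^ 2 • (1 : Matrix (Fin m) (Fin m) ℝ))

/-- A linear regression task with `m` data points in dimension `d`: a design matrix and a
coefficient vector. -/
structure Task (m d : ℕ) where
  /-- the design matrix -/
  design : Matrix (Fin m) (Fin d) ℝ
  /-- the coefficient vector, which is to be learned -/
  param : EuclideanSpace ℝ (Fin d)

/-- The law of the `m` responses of a task, with noise level `σ`. -/
def Task.law {m d : ℕ} (σ : ℝ) (P : Task m d) : Measure (EuclideanSpace ℝ (Fin m)) :=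
  regressionLaw σ P.design P.param

/-- The class of linear regression tasks with `m` data points whose coefficient vector lies in the
closed unit `ℓ₂` ball and whose design satisfies `σ_max(X / √m) ≤ γ`. -/
def taskClass (m d : ℕ) (γ : ℝ) : Set (Task m d) :=
  {P | ‖P.param‖ ≤ 1 ∧ sigmaMax ((√(m : ℝ))⁻¹ • P.design) ≤ γ}

/-- A two-stage estimator: the meta-training responses are mapped to an estimation algorithm, which
maps the responses of the novel task to an estimate of its coefficient vector. -/
abbrev Estimator (M n k d : ℕ) : Type :=
  (Fin M → EuclideanSpace ℝ (Fin n)) → EuclideanSpace ℝ (Fin k) → EuclideanSpace ℝ (Fin d)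

/-- The expected squared `ℓ₂` loss of a two-stage estimator when the `M` meta-training tasks are
`P 0, …, P (M - 1)` and the novel task is `Q`; all responses are independent. -/
def expectedLoss {M n k d : ℕ} (σ : ℝ) (P : Fin M → Task n d) (Q : Task k d)
    (f : Estimator M n k d) : ℝ≥0∞ :=
  ∫⁻ S, ENNReal.ofReal (‖f S.1 S.2 - Q.param‖ ^ 2)
    ∂((Measure.pi fun i => (P i).law σ).prod (Q.law σ))

/-- The novel-task minimax risk over the class of linear regression tasks: the supremum runs over
all `M` meta-training tasks (`n` data points each) and all novel tasks (`k` data points) in the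
class. Design matrices are observed, so the estimator may depend on them. -/
def minimaxRisk (M n k d : ℕ) (σ γ : ℝ) : ℝ≥0∞ :=
  ⨅ (f : (Fin M → Matrix (Fin n) (Fin d) ℝ) → Matrix (Fin k) (Fin d) ℝ → Estimator M n k d)
    (_ : ∀ X X', Measurable (Function.uncurry (f X X'))),
  ⨆ (P : Fin M → Task n d) (_ : ∀ i, P i ∈ taskClass n d γ)
    (Q : Task k d) (_ : Q ∈ taskClass k d γ),
    expectedLoss σ P Q (f (fun i => (P i).design) Q.design)

/-- The novel-task minimax risk for prescribed design matrices `X 0, …, X (M - 1)` and `X'`: only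
the coefficient vectors vary, over the closed unit `ℓ₂` ball. -/
def fixedDesignMinimaxRisk {M n k d : ℕ} (σ : ℝ) (X : Fin M → Matrix (Fin n) (Fin d) ℝ)
    (X' : Matrix (Fin k) (Fin d) ℝ) : ℝ≥0∞ :=
  ⨅ (f : Estimator M n k d) (_ : Measurable (Function.uncurry f)),
  ⨆ (θ : Fin M → EuclideanSpace ℝ (Fin d)) (_ : ∀ i, ‖θ i‖ ≤ 1)
    (θ' : EuclideanSpace ℝ (Fin d)) (_ : ‖θ'‖ ≤ 1),
    expectedLoss σ (fun i => ⟨X i, θ i⟩) ⟨X', θ'⟩ f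

end MetaLinReg

end

/-! Since `2^{-d} n M ≥ 0`, it suffices to prove the single-task rate `min (1, d σ² / (γ² k))` (just
`1` if `k = 0`), and this holds even when all meta-training parameters are `0`, as their data then
say nothing about the novel task. That rate is Assouad's bound on the cube `{±δ}^d`: adjacent
vertices have response means at most `2σ` apart, so by `exists_le_multivariateGaussian` their laws
share a part of mass at least `overlap`. On that part no estimator can tell the sign of the
coordinate, which costs `δ²` per coordinate (`two_point_lower_bound`). Averaging over vertices gives
`overlap * d * δ²`. -/

namespace MetaLinReg

open ProbabilityTheory
open scoped RealInnerProductSpace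

/-! ### Singular values and isotropic Gaussian laws. -/

/-- The largest singular value bounds the expansion of a linear map. -/
lemma norm_apply_le_singularValues_zero_mul {E F : Type*} [NormedAddCommGroup E]
    [InnerProductSpace ℝ E] [FiniteDimensional ℝ E] [NormedAddCommGroup F] [InnerProductSpace ℝ F]
    [FiniteDimensional ℝ F] (T : E →ₗ[ℝ] F) (x : E) :
    ‖T x‖ ≤ T.singularValues 0 * ‖x‖ := by
  have hS := T.isSymmetric_adjoint_comp_self
  set b := hS.eigenvectorBasis rfl with hb
  refine le_of_sq_le_sq ?_ (mul_nonneg (T.singularValues_nonneg 0) (norm_nonneg x))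
  have h1 : ‖T x‖ ^ 2 = ∑ i : Fin (Module.finrank ℝ E), T.singularValues i ^ 2 * ⟪b i, x⟫ ^ 2 := by
    have h2 : ‖T x‖ ^ 2 = ⟪x, (LinearMap.adjoint T ∘ₗ T) x⟫ := by
      rw [LinearMap.comp_apply, LinearMap.adjoint_inner_right, real_inner_self_eq_norm_sq]
    rw [h2, ← b.sum_inner_mul_inner x]
    refine Finset.sum_congr rfl fun i _ => ?_
    rw [← hS, hS.apply_eigenvectorBasis, inner_smul_left, T.sq_singularValues_fin rfl,
      real_inner_comm x]
    simp only [RCLike.ofReal_real_eq_id, id_eq, conj_trivial]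
    ring
  rw [h1, mul_pow, ← b.sum_sq_inner_right x, Finset.mul_sum]
  gcongr with i
  · exact T.singularValues_nonneg i
  · exact T.singularValues_antitone (Nat.zero_le i)

lemma norm_toLpLin_le_of_sigmaMax_le {k d : ℕ} {γ : ℝ} {X : Matrix (Fin k) (Fin d) ℝ}
    (hX : sigmaMax ((√(k : ℝ))⁻¹ • X) ≤ γ) (v : EuclideanSpace ℝ (Fin d)) :
    ‖Matrix.toLpLin 2 2 X v‖ ≤ √k * (γ * ‖v‖) := by
  rcases Nat.eq_zero_or_pos k with rfl | hk
  -- For `k = 0` the scaling `(√0)⁻¹` is `0`, so `hX` says nothing about `X`, but the codomain is a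
  -- point.
  · rw [Subsingleton.elim (Matrix.toLpLin 2 2 X v) 0]
    simp
  · have hk' : 0 < √(k : ℝ) := Real.sqrt_pos.2 (by exact_mod_cast hk)
    have h := norm_apply_le_singularValues_zero_mul
      (Matrix.toLpLin 2 2 ((√(k : ℝ))⁻¹ • X)) v
    have h' := h.trans (mul_le_mul_of_nonneg_right hX (norm_nonneg v))
    rw [map_smul, LinearMap.smul_apply, norm_smul, norm_inv, Real.norm_of_nonneg hk'.le] at h'
    rwa [inv_mul_le_iff₀ hk'] at h'

lemma multivariateGaussian_sq_smul_one {k : ℕ} (μ : EuclideanSpace ℝ (Fin k)) {σ : ℝ}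
    (hσ : 0 ≤ σ) :
    multivariateGaussian μ (σ ^ 2 • (1 : Matrix (Fin k) (Fin k) ℝ)) =
      (stdGaussian (EuclideanSpace ℝ (Fin k))).map (fun x => μ + σ • x) := by
  have hpos : (σ ^ 2 • (1 : Matrix (Fin k) (Fin k) ℝ)).PosSemidef :=
    Matrix.PosSemidef.one.smul (sq_nonneg σ)
  have : (fun x : EuclideanSpace ℝ (Fin k) => μ + σ • x) = (μ + ·) ∘ (σ • ·) := rfl
  rw [this, ← Measure.map_map (by fun_prop) (by fun_prop)]
  apply Measure.ext_of_charFun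
  ext t
  simp only [charFun_multivariateGaussian hpos, charFun_map_const_add, charFun_map_smul,
    charFun_stdGaussian]
  rw [← Complex.exp_add]
  congr 1
  have : t.ofLp ⬝ᵥ t.ofLp = ‖t‖ ^ 2 := by
    rw [← real_inner_self_eq_norm_sq, PiLp.inner_apply]
    simp [dotProduct, sq]
  simp only [Matrix.smul_mulVec, Matrix.one_mulVec, dotProduct_smul, this, norm_smul,
    Real.norm_of_nonneg hσ, smul_eq_mul, real_inner_comm μ t]
  push_cast
  ring

/-! ### Common part of two Gaussian laws. -/

section TwoPoint

variable {E : Type*} [NormedAddCommGroup E] [InnerProductSpace ℝ E] [FiniteDimensional ℝ E]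
  [MeasurableSpace E] [BorelSpace E]

lemma measurable_smul_add_sub_inner_smul (e : E) :
    Measurable fun p : ℝ × E => p.1 • e + (p.2 - ⟪e, p.2⟫ • e) := by
  fun_prop

/-- The component of a standard Gaussian vector along a unit vector is an independent standard
Gaussian variable. -/
lemma stdGaussian_eq_map_prod {e : E} (he : ‖e‖ = 1) :
    stdGaussian E = ((gaussianReal 0 1).prod (stdGaussian E)).map
      (fun p => p.1 • e + (p.2 - ⟪e, p.2⟫ • e)) := by
  have hm := measurable_smul_add_sub_inner_smul e
  have := Measure.isProbabilityMeasure_map (μ := (gaussianReal 0 1).prod (stdGaussian E))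
    hm.aemeasurable
  apply Measure.ext_of_charFun
  ext t
  rw [charFun_apply (μ := Measure.map _ _), integral_map hm.aemeasurable (by fun_prop)]
  have hpt : ∀ p : ℝ × E, Complex.exp (⟪p.1 • e + (p.2 - ⟪e, p.2⟫ • e), t⟫ * Complex.I) =
      Complex.exp (⟪p.1, ⟪e, t⟫⟫ * Complex.I) *
        Complex.exp (⟪p.2, t - ⟪e, t⟫ • e⟫ * Complex.I) := by
    intro p
    rw [← Complex.exp_add, ← add_mul, ← Complex.ofReal_add]
    congr 3
    simp only [inner_add_left, inner_sub_left, inner_sub_right, real_inner_smul_left,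
      real_inner_smul_right, real_inner_comm p.2 e]
    simp
    ring
  simp_rw [hpt]
  rw [integral_prod_mul (fun x : ℝ => Complex.exp (⟪x, ⟪e, t⟫⟫ * Complex.I))
    (fun x : E => Complex.exp (⟪x, t - ⟪e, t⟫ • e⟫ * Complex.I)), ← charFun_apply,
    ← charFun_apply, charFun_gaussianReal, charFun_stdGaussian, charFun_stdGaussian,
    ← Complex.exp_add]
  congr 1
  have : ‖t - ⟪e, t⟫ • e‖ ^ 2 = ‖t‖ ^ 2 - ⟪e, t⟫ ^ 2 := by
    rw [norm_sub_sq_real, norm_smul, he, real_inner_smul_right, real_inner_comm e t]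
    simp
    ring
  rw [← Complex.ofReal_pow ‖t - _‖, this]
  push_cast
  ring

/-- A shift along `e` is absorbed by the independent `e`-component, so comparing shifted laws
becomes a one-dimensional problem. -/
lemma map_const_add_stdGaussian {e : E} (he : ‖e‖ = 1) (s : ℝ) :
    (stdGaussian E).map (s • e + ·) = ((gaussianReal s 1).prod (stdGaussian E)).map
      (fun p => p.1 • e + (p.2 - ⟪e, p.2⟫ • e)) := by
  have hm := measurable_smul_add_sub_inner_smul e
  have h1 : gaussianReal s 1 = (gaussianReal 0 1).map (s + ·) := by
    rw [gaussianReal_map_const_add, zero_add]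
  conv_lhs => rw [stdGaussian_eq_map_prod he]
  rw [Measure.map_map (by fun_prop) hm, h1]
  conv_rhs => rw [← Measure.map_id (μ := stdGaussian E)]
  rw [Measure.map_prod_map _ _ (by fun_prop) measurable_id, Measure.map_map hm (by fun_prop)]
  congr 1
  ext p
  simp [add_smul, add_assoc]

/-- A lower bound for the density on `[-1, 1]` of the normal laws with variance `1` and mean in
`[-1, 1]`. -/
noncomputable def overlap : ℝ := (√(2 * Real.pi))⁻¹ * Real.exp (-2)

lemma overlap_pos : 0 < overlap := by
  unfold overlap; positivity

lemma overlap_smul_le_gaussianReal {s : ℝ} (hs : |s| ≤ 1) :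
    ENNReal.ofReal overlap • (volume.restrict (Set.Icc (-1 : ℝ) 1)) ≤ gaussianReal s 1 := by
  rw [gaussianReal_of_var_ne_zero s one_ne_zero, ← withDensity_const,
    ← withDensity_indicator measurableSet_Icc]
  refine withDensity_mono (Filter.Eventually.of_forall fun x => ?_)
  by_cases hx : x ∈ Set.Icc (-1 : ℝ) 1
  · rw [Set.indicator_of_mem hx, gaussianPDF_def]
    refine ENNReal.ofReal_le_ofReal ?_
    rw [gaussianPDFReal, overlap]
    simp only [NNReal.coe_one, mul_one]
    gcongr
    obtain ⟨h1, h2⟩ := abs_le.1 hs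
    -- `|x - s| ≤ 2`, so the Gaussian exponent is at least `-2`.
    nlinarith [hx.1, hx.2]
  · rw [Set.indicator_of_notMem hx]
    exact zero_le

/-- Two standard Gaussian laws with centres at distance at most `2` have a common part of mass
bounded below. -/
lemma exists_le_map_add_stdGaussian {u : E} (hu : ‖u‖ ≤ 1) :
    ∃ ρ : Measure E, SFinite ρ ∧ ENNReal.ofReal overlap ≤ ρ Set.univ ∧
      ρ ≤ (stdGaussian E).map (u + ·) ∧ ρ ≤ (stdGaussian E).map (-u + ·) := by
  rcases eq_or_ne u 0 with rfl | hu0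
  · refine ⟨stdGaussian E, inferInstance, ?_, ?_, ?_⟩
    · rw [measure_univ, ENNReal.ofReal_le_one, overlap]
      have : 1 ≤ √(2 * Real.pi) := Real.one_le_sqrt.2 (by linarith [Real.pi_gt_three])
      exact mul_le_one₀ (inv_le_one_of_one_le₀ this) (Real.exp_pos _).le
        (Real.exp_le_one_iff.2 (by norm_num))
    · simp
    · simp
  · set e : E := ‖u‖⁻¹ • u
    have he : ‖e‖ = 1 := norm_smul_inv_norm hu0
    have hue : u = ‖u‖ • e := by
      rw [smul_smul, mul_inv_cancel₀ (norm_ne_zero_iff.2 hu0), one_smul]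
    have hm := measurable_smul_add_sub_inner_smul e
    have hneg : -u = (-‖u‖) • e := by rw [neg_smul, ← hue]
    refine ⟨((ENNReal.ofReal overlap • (volume.restrict (Set.Icc (-1 : ℝ) 1))).prod
      (stdGaussian E)).map (fun p => p.1 • e + (p.2 - ⟪e, p.2⟫ • e)), inferInstance, ?_, ?_, ?_⟩
    · rw [Measure.map_apply hm MeasurableSet.univ, Set.preimage_univ, ← Set.univ_prod_univ,
        Measure.prod_prod]
      simp only [Measure.smul_apply, Measure.restrict_apply_univ, Real.volume_Icc, measure_univ,
        smul_eq_mul, mul_one]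
      -- The interval has length `2`; this factor is dropped.
      exact le_mul_of_one_le_right' (by norm_num)
    · rw [hue, map_const_add_stdGaussian he]
      exact Measure.map_mono (Measure.prod_mono
        (overlap_smul_le_gaussianReal (by simpa using hu)) le_rfl) hm
    · rw [hneg, map_const_add_stdGaussian he]
      exact Measure.map_mono (Measure.prod_mono
        (overlap_smul_le_gaussianReal (by simpa using hu)) le_rfl) hm

end TwoPoint

lemma exists_le_multivariateGaussian {k : ℕ} {σ : ℝ} (hσ : 0 < σ)
    {μ₁ μ₂ : EuclideanSpace ℝ (Fin k)} (h : ‖μ₁ - μ₂‖ ≤ 2 * σ) :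
    ∃ ρ : Measure (EuclideanSpace ℝ (Fin k)), SFinite ρ ∧
      ENNReal.ofReal overlap ≤ ρ Set.univ ∧
      ρ ≤ multivariateGaussian μ₁ (σ ^ 2 • (1 : Matrix (Fin k) (Fin k) ℝ)) ∧
      ρ ≤ multivariateGaussian μ₂ (σ ^ 2 • (1 : Matrix (Fin k) (Fin k) ℝ)) := by
  set u := (2 * σ)⁻¹ • (μ₁ - μ₂) with hu
  have hu1 : ‖u‖ ≤ 1 := by
    rw [hu, norm_smul, norm_inv, Real.norm_of_nonneg (by positivity),
      inv_mul_le_iff₀ (by positivity)]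
    simpa using h
  obtain ⟨ρ, hρ, hmass, h1, h2⟩ := exists_le_map_add_stdGaussian hu1
  -- Scaling by `σ` about the midpoint sends the centres `u`, `-u` to `μ₁`, `μ₂`.
  set T : EuclideanSpace ℝ (Fin k) → EuclideanSpace ℝ (Fin k) :=
    fun x => (2 : ℝ)⁻¹ • (μ₁ + μ₂) + σ • x with hT
  have hTm : Measurable T := by fun_prop
  have hTu : σ • u = (2 : ℝ)⁻¹ • (μ₁ - μ₂) := by
    rw [hu, smul_smul]
    congr 1
    field_simp
  refine ⟨ρ.map T, inferInstance, ?_, ?_, ?_⟩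
  · rwa [Measure.map_apply hTm MeasurableSet.univ, Set.preimage_univ]
  · refine (Measure.map_mono h1 hTm).trans_eq ?_
    rw [multivariateGaussian_sq_smul_one _ hσ.le, Measure.map_map hTm (by fun_prop)]
    congr 1
    ext1 x
    simp only [hT, Function.comp_apply, smul_add, hTu]
    module
  · refine (Measure.map_mono h2 hTm).trans_eq ?_
    rw [multivariateGaussian_sq_smul_one _ hσ.le, Measure.map_map hTm (by fun_prop)]
    congr 1
    ext1 x
    simp only [hT, Function.comp_apply, smul_add, smul_neg, hTu]
    module

/-! ### Le Cam's and Assouad's bounds. -/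

/-- Le Cam's two-point bound for squared loss, in terms of a common minorant of the two laws. -/
lemma two_point_lower_bound {α β : Type*} [MeasurableSpace α] [MeasurableSpace β]
    {μ : Measure α} [IsProbabilityMeasure μ] {ν₁ ν₂ ρ : Measure β} [SFinite ν₁] [SFinite ν₂]
    [SFinite ρ] (h1 : ρ ≤ ν₁) (h2 : ρ ≤ ν₂) {g : α × β → ℝ} (hg : Measurable g) (a : ℝ) :
    2 * (ENNReal.ofReal (a ^ 2) * ρ Set.univ) ≤
      ∫⁻ z, ENNReal.ofReal ((g z - a) ^ 2) ∂(μ.prod ν₁) +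
        ∫⁻ z, ENNReal.ofReal ((g z + a) ^ 2) ∂(μ.prod ν₂) := by
  calc 2 * (ENNReal.ofReal (a ^ 2) * ρ Set.univ)
      = ∫⁻ _, 2 * ENNReal.ofReal (a ^ 2) ∂(μ.prod ρ) := by
        rw [lintegral_const, ← Set.univ_prod_univ, Measure.prod_prod,
          measure_univ (μ := μ), one_mul, mul_assoc]
    _ ≤ ∫⁻ z, (ENNReal.ofReal ((g z - a) ^ 2) + ENNReal.ofReal ((g z + a) ^ 2)) ∂(μ.prod ρ) := by
        refine lintegral_mono fun z => ?_
        rw [← ENNReal.ofReal_add (sq_nonneg _) (sq_nonneg _), ← ENNReal.ofReal_ofNat 2,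
          ← ENNReal.ofReal_mul (by norm_num)]
        -- `(g - a)² + (g + a)² = 2g² + 2a²`.
        exact ENNReal.ofReal_le_ofReal (by nlinarith [sq_nonneg (g z)])
    _ = ∫⁻ z, ENNReal.ofReal ((g z - a) ^ 2) ∂(μ.prod ρ) +
        ∫⁻ z, ENNReal.ofReal ((g z + a) ^ 2) ∂(μ.prod ρ) := lintegral_add_left (by fun_prop) _
    _ ≤ _ := add_le_add (lintegral_mono' (Measure.prod_mono le_rfl h1) le_rfl)
        (lintegral_mono' (Measure.prod_mono le_rfl h2) le_rfl)

/-- The involution of the hypercube that flips coordinate `j`. -/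
def flip {d : ℕ} (j : Fin d) : Equiv.Perm (Fin d → Bool) :=
  Function.Involutive.toPerm (fun v => Function.update v j (!v j)) fun v => by simp

lemma flip_apply {d : ℕ} (j : Fin d) (v : Fin d → Bool) :
    flip j v = Function.update v j (!v j) := rfl

/-- Flipping permutes the cube, so summing the pair bounds counts each `A v` twice. -/
lemma card_mul_le_sum_of_flip {d : ℕ} (j : Fin d) {A : (Fin d → Bool) → ℝ≥0∞} {c : ℝ≥0∞}
    (h : ∀ v, 2 * c ≤ A v + A (flip j v)) :
    Fintype.card (Fin d → Bool) * c ≤ ∑ v, A v := by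
  have h2 : 2 * (Fintype.card (Fin d → Bool) * c) ≤ 2 * ∑ v, A v := by
    calc 2 * (Fintype.card (Fin d → Bool) * c) = ∑ _v : Fin d → Bool, 2 * c := by
          rw [Finset.sum_const, Finset.card_univ, nsmul_eq_mul]; ring
      _ ≤ ∑ v, (A v + A (flip j v)) := Finset.sum_le_sum fun v _ => h v
      _ = 2 * ∑ v, A v := by rw [Finset.sum_add_distrib, Equiv.sum_comp (flip j) A, two_mul]
  exact (ENNReal.mul_le_mul_iff_right two_ne_zero ENNReal.ofNat_ne_top).1 h2

/-- The vertices of the cube `[-δ, δ]ᵈ`. -/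
noncomputable def cubeVertex {d : ℕ} (δ : ℝ) (v : Fin d → Bool) : EuclideanSpace ℝ (Fin d) :=
  WithLp.toLp 2 fun j => if v j then δ else -δ

lemma norm_cubeVertex_sq {d : ℕ} (δ : ℝ) (v : Fin d → Bool) :
    ‖cubeVertex δ v‖ ^ 2 = d * δ ^ 2 := by
  have : ∀ j, cubeVertex δ v j ^ 2 = δ ^ 2 := fun j => by
    unfold cubeVertex; dsimp only; split_ifs <;> ring
  simp [EuclideanSpace.real_norm_sq_eq, this]

lemma cubeVertex_flip_apply_self {d : ℕ} (δ : ℝ) (v : Fin d → Bool) (j : Fin d) :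
    cubeVertex δ (flip j v) j = -cubeVertex δ v j := by
  cases h : v j <;> simp [cubeVertex, flip_apply, h]

lemma norm_cubeVertex_sub_flip {d : ℕ} {δ : ℝ} (hδ : 0 ≤ δ) (v : Fin d → Bool) (j : Fin d) :
    ‖cubeVertex δ v - cubeVertex δ (flip j v)‖ = 2 * δ := by
  have : cubeVertex δ v - cubeVertex δ (flip j v) =
      EuclideanSpace.single j (2 * cubeVertex δ v j) := by
    ext i
    rcases eq_or_ne i j with rfl | hij
    · rw [PiLp.sub_apply, cubeVertex_flip_apply_self]
      simp; ring
    · simp [cubeVertex, flip_apply, hij]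
  rw [this, PiLp.norm_single]
  unfold cubeVertex
  dsimp only
  split_ifs <;> simp [abs_of_nonneg hδ]

lemma isProbabilityMeasure_regressionLaw {m d : ℕ} (σ : ℝ) (X : Matrix (Fin m) (Fin d) ℝ)
    (θ : EuclideanSpace ℝ (Fin d)) : IsProbabilityMeasure (regressionLaw σ X θ) := by
  unfold regressionLaw; infer_instance

/-- Assouad's bound over the vertices of a cube, for prescribed design matrices. -/
lemma le_fixedDesignMinimaxRisk {M n k d : ℕ} {σ γ δ : ℝ} (hσ : 0 < σ) (hδ : 0 ≤ δ)
    (X : Fin M → Matrix (Fin n) (Fin d) ℝ) {X' : Matrix (Fin k) (Fin d) ℝ}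
    (hX' : sigmaMax ((√(k : ℝ))⁻¹ • X') ≤ γ) (hball : d * δ ^ 2 ≤ 1)
    (hsep : √k * (γ * δ) ≤ σ) :
    ENNReal.ofReal (overlap * (d * δ ^ 2)) ≤ fixedDesignMinimaxRisk σ X X' := by
  refine le_iInf₂ fun f hf => ?_
  -- With these parameters fixed, the meta-training law `μ` is the same for every vertex.
  set θ : Fin M → EuclideanSpace ℝ (Fin d) := fun _ => 0
  have hprob := @isProbabilityMeasure_regressionLaw
  set μ := Measure.pi fun i => regressionLaw σ (X i) (θ i) with hμ
  have hcoord : ∀ j, Measurable fun S : (Fin M → EuclideanSpace ℝ (Fin n)) ×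
      EuclideanSpace ℝ (Fin k) => f S.1 S.2 j := fun j =>
    (EuclideanSpace.proj (𝕜 := ℝ) j).continuous.measurable.comp hf
  set A : Fin d → (Fin d → Bool) → ℝ≥0∞ := fun j v =>
    ∫⁻ S, ENNReal.ofReal ((f S.1 S.2 j - cubeVertex δ v j) ^ 2)
      ∂(μ.prod (regressionLaw σ X' (cubeVertex δ v))) with hA
  have hloss : ∀ v, expectedLoss σ (fun i => ⟨X i, θ i⟩) ⟨X', cubeVertex δ v⟩ f =
      ∑ j, A j v := by
    intro v
    rw [hA, ← lintegral_finsetSum _ fun j _ => by have := hcoord j; fun_prop]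
    refine lintegral_congr fun S => ?_
    rw [EuclideanSpace.real_norm_sq_eq, ENNReal.ofReal_sum_of_nonneg fun _ _ => sq_nonneg _]
    simp
  have hpair : ∀ j v, 2 * (ENNReal.ofReal (δ ^ 2) * ENNReal.ofReal overlap) ≤
      A j v + A j (flip j v) := by
    intro j v
    -- Adjacent vertices are `2δ` apart and `X'` expands by at most `√k * γ`.
    have hdist : ‖Matrix.toLpLin 2 2 X' (cubeVertex δ v) -
        Matrix.toLpLin 2 2 X' (cubeVertex δ (flip j v))‖ ≤ 2 * σ := by
      rw [← map_sub]
      refine (norm_toLpLin_le_of_sigmaMax_le hX' _).trans ?_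
      rw [norm_cubeVertex_sub_flip hδ]
      linarith
    obtain ⟨ρ, hρ, hmass, h1, h2⟩ := exists_le_multivariateGaussian hσ hdist
    have h := two_point_lower_bound (μ := μ) h1 h2 (hcoord j) (cubeVertex δ v j)
    have hsq : cubeVertex δ v j ^ 2 = δ ^ 2 := by
      unfold cubeVertex; dsimp only; split_ifs <;> ring
    rw [hsq] at h
    refine le_trans (by gcongr) (h.trans_eq ?_)
    simp only [hA, cubeVertex_flip_apply_self, sub_neg_eq_add]
    rfl
  -- The worst case over the ball dominates the average over the vertices.
  set R : ℝ≥0∞ := ⨆ (θ : Fin M → EuclideanSpace ℝ (Fin d)) (_ : ∀ i, ‖θ i‖ ≤ 1)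
    (θ' : EuclideanSpace ℝ (Fin d)) (_ : ‖θ'‖ ≤ 1),
    expectedLoss σ (fun i => ⟨X i, θ i⟩) ⟨X', θ'⟩ f
  have hsum : (Fintype.card (Fin d → Bool) : ℝ≥0∞) * ENNReal.ofReal (overlap * (d * δ ^ 2)) ≤
      Fintype.card (Fin d → Bool) * R := by
    calc (Fintype.card (Fin d → Bool) : ℝ≥0∞) * ENNReal.ofReal (overlap * (d * δ ^ 2))
        = ∑ _j : Fin d, (Fintype.card (Fin d → Bool) : ℝ≥0∞) *
            (ENNReal.ofReal (δ ^ 2) * ENNReal.ofReal overlap) := by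
          rw [Finset.sum_const, Finset.card_univ, Fintype.card_fin, nsmul_eq_mul,
            ENNReal.ofReal_mul overlap_pos.le, ENNReal.ofReal_mul (Nat.cast_nonneg d),
            ENNReal.ofReal_natCast]
          ring
      _ ≤ ∑ j, ∑ v, A j v := Finset.sum_le_sum fun j _ => card_mul_le_sum_of_flip j (hpair j)
      _ = ∑ v, expectedLoss σ (fun i => ⟨X i, θ i⟩) ⟨X', cubeVertex δ v⟩ f := by
          rw [Finset.sum_comm]
          exact Finset.sum_congr rfl fun v _ => (hloss v).symm
      _ ≤ ∑ _v : Fin d → Bool, R := by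
          refine Finset.sum_le_sum fun v _ => ?_
          have hv : ‖cubeVertex δ v‖ ≤ 1 := by
            rw [← sq_le_one_iff₀ (norm_nonneg _), norm_cubeVertex_sq]
            exact hball
          exact le_iSup₂_of_le θ (fun i => by simp [θ]) (le_iSup₂_of_le (cubeVertex δ v) hv le_rfl)
      _ = _ := by rw [Finset.sum_const, Finset.card_univ, nsmul_eq_mul]
  exact (ENNReal.mul_le_mul_iff_right (by simp) (ENNReal.natCast_ne_top _)).1 hsum

/-- A design-dependent estimator evaluated at `X`, `X'` competes in the fixed-design problem, whose
supremum runs over fewer tasks. -/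
lemma fixedDesignMinimaxRisk_le_minimaxRisk {M n k d : ℕ} {σ γ : ℝ}
    {X : Fin M → Matrix (Fin n) (Fin d) ℝ} {X' : Matrix (Fin k) (Fin d) ℝ}
    (hX : ∀ i, sigmaMax ((√(n : ℝ))⁻¹ • X i) ≤ γ) (hX' : sigmaMax ((√(k : ℝ))⁻¹ • X') ≤ γ) :
    fixedDesignMinimaxRisk σ X X' ≤ minimaxRisk M n k d σ γ := by
  refine le_iInf₂ fun f hf => (iInf₂_le (f X X') (hf X X')).trans ?_
  refine iSup₂_le fun θ hθ => iSup₂_le fun θ' hθ' => ?_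
  exact le_iSup₂_of_le (fun i => ⟨X i, θ i⟩) (fun i => ⟨hθ i, hX i⟩)
    (le_iSup₂_of_le ⟨X', θ'⟩ ⟨hθ', hX'⟩ le_rfl)

lemma sigmaMax_zero {m d : ℕ} : sigmaMax (0 : Matrix (Fin m) (Fin d) ℝ) = 0 := by
  simp [sigmaMax]

end MetaLinReg

/-! ### Choice of `δ` and conclusion. -/

theorem theorem3 :
    ∃ c : ℝ, 0 < c ∧
      ∀ (d n M k : ℕ) (σ γ : ℝ), 2 < d → 0 < n * M + k → 0 < σ → 0 < γ →
        ENNReal.ofReal (c * min 1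
            ((d : ℝ) * σ ^ 2 / (γ ^ 2 * (((2 : ℝ) ^ d)⁻¹ * (n : ℝ) * (M : ℝ) + (k : ℝ)))))
          ≤ MetaLinReg.minimaxRisk M n k d σ γ ∧
        ∀ (X : Fin M → Matrix (Fin n) (Fin d) ℝ) (X' : Matrix (Fin k) (Fin d) ℝ),
          (∀ i, MetaLinReg.sigmaMax ((√(n : ℝ))⁻¹ • X i) ≤ γ) →
          MetaLinReg.sigmaMax ((√(k : ℝ))⁻¹ • X') ≤ γ →
          ENNReal.ofReal (c * min 1
              ((d : ℝ) * σ ^ 2 / (γ ^ 2 * (((2 : ℝ) ^ d)⁻¹ * (n : ℝ) * (M : ℝ) + (k : ℝ)))))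
            ≤ MetaLinReg.fixedDesignMinimaxRisk σ X X' := by
  refine ⟨MetaLinReg.overlap, MetaLinReg.overlap_pos, fun d n M k σ γ hd hN hσ hγ => ?_⟩
  set D : ℝ := ((2 : ℝ) ^ d)⁻¹ * (n : ℝ) * (M : ℝ) + (k : ℝ) with hD
  set r : ℝ := (d : ℝ) * σ ^ 2 / (γ ^ 2 * D) with hr
  -- The meta-training term only enlarges `D`; its other role is to keep `D` positive when `k = 0`.
  have hkD : (k : ℝ) ≤ D := le_add_of_nonneg_left (by positivity)
  have hDpos : 0 < D := by
    rcases Nat.eq_zero_or_pos k with rfl | hk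
    · have hnM : 0 < (n : ℝ) * M := by exact_mod_cast hN
      rw [hD, mul_assoc]
      positivity
    · exact lt_of_lt_of_le (by exact_mod_cast hk) hkD
  have hd0 : (0 : ℝ) < d := by exact_mod_cast (by omega : 0 < d)
  -- `δ² = min 1 r / d`: the `1` keeps the cube in the unit ball, the `r` keeps adjacent means
  -- within `2σ`.
  have hδ : (d : ℝ) * √(min 1 r / d) ^ 2 = min 1 r := by
    rw [Real.sq_sqrt (by positivity)]
    field_simp
  have hsep : √k * (γ * √(min 1 r / d)) ≤ σ := by
    refine le_of_sq_le_sq ?_ hσ.le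
    rw [mul_pow, mul_pow, Real.sq_sqrt (Nat.cast_nonneg k), Real.sq_sqrt (by positivity)]
    calc (k : ℝ) * (γ ^ 2 * (min 1 r / d)) ≤ D * (γ ^ 2 * (r / d)) := by
          gcongr
          exact min_le_right _ _
      _ = σ ^ 2 := by rw [hr]; field_simp
  have hfixed : ∀ (X : Fin M → Matrix (Fin n) (Fin d) ℝ) (X' : Matrix (Fin k) (Fin d) ℝ),
      MetaLinReg.sigmaMax ((√(k : ℝ))⁻¹ • X') ≤ γ →
      ENNReal.ofReal (MetaLinReg.overlap * min 1 r) ≤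
        MetaLinReg.fixedDesignMinimaxRisk σ X X' := by
    intro X X' hX'
    rw [← hδ]
    exact MetaLinReg.le_fixedDesignMinimaxRisk hσ (Real.sqrt_nonneg _) X hX'
      (hδ.le.trans (min_le_left _ _)) hsep
  have hzero : ∀ m : ℕ,
      MetaLinReg.sigmaMax ((√(m : ℝ))⁻¹ • (0 : Matrix (Fin m) (Fin d) ℝ)) ≤ γ := fun m => by
    rw [smul_zero, MetaLinReg.sigmaMax_zero]
    exact hγ.le
  -- Zero designs are admissible, so they already give the bound over the whole class.
  exact ⟨(hfixed 0 0 (hzero k)).trans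
    (MetaLinReg.fixedDesignMinimaxRisk_le_minimaxRisk (fun _ => hzero n) (hzero k)),
    fun X X' _ hX' => hfixed X X' hX'⟩
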